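/- There is a function $\ell:\mathbb{R}\to\mathbb{R}$ with $\ell(y)=y+O(y^2)$ as $y\to 0$, independent of all the data below (in particular of all dimensions), such that the following holds. Let $L$ (logical) and $S$ (physical) be nonzero finite-dimensional quantum systems with Hermitian Hamiltonians $H_L$, $H_S$, where $H_S$ is not a multiple of the identity, and let $U_{L,\theta}=e^{-iH_L\theta}$, $U_{S,\theta}=e^{-iH_S\theta}$ for $\theta\in\mathbb{R}$, with channels $\mathcal{U}_{L,\theta}(\cdot)=U_{L,\theta}(\cdot)U_{L,\theta}^\dagger$ and $\mathcal{U}_{S,\theta}(\cdot)=U_{S,\theta}(\cdot)U_{S,\theta}^\dagger$. Let $\mathcal{E}(\rho)=W\rho W^\dagger$ with $W^\dagger W=\mathbb{1}$ be an isometric encoding of $L$ into $S$, and let $\mathcal{N}(\rho)=\sum_i K_i\rho K_i^\dagger$, $\sum_i K_i^\dagger K_i=\mathbb{1}$ (a finite sum), be a noise channel on $S$ such that $H_S\in\mathrm{span}\{K_i^\dagger K_j\}_{i,j}$. Then $$\delta_G\ \ge\ \ell\!\left(\sqrt{\frac{\Delta H_L-2\epsilon\mathfrak{J}}{\Delta H_S}}\right)$$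 (the square root being read as $0$ if $\Delta H_L<2\epsilon\mathfrak{J}$). Here $\Delta$ denotes the difference between the largest and the smallest eigenvalue of a Hermitian matrix; $$\delta_G=\sup_{\theta\in\mathbb{R}}P(\mathcal{U}_{S,\theta}\circ\mathcal{E},\ \mathcal{E}\circ\mathcal{U}_{L,\theta}),\qquad \epsilon=\inf_{\mathcal{R}}P(\mathcal{R}\circ\mathcal{N}\circ\mathcal{E},\ \mathbb{1}_L),$$ where the infimum is over all quantum channels (completely positive trace-preserving maps) $\mathcal{R}$ from $S$ to $L$; $$\mathfrak{J}=\inf\Big\{\Delta h:\ h=h^\dagger,\ H_S=\sum_{ij}h_{ij}K_i^\dagger K_j\Big\};$$ and $P$ is the channel purified distance $P(\Phi_1,\Phi_2)=\sup_\rho P\big((\Phi_1\otimes\mathbb{1})(\rho),(\Phi_2\otimes\mathbb{1})(\rho)\big)$ over all states $\rho$ of the input and a finite-dimensional reference system, with $P(\rho,\sigma)=\sqrt{1-f(\rho,\sigma)^2}$ and $f(\rho,\sigma)=\mathrm{Tr}\sqrt{\rho^{1/2}\sigma\rho^{1/2}}$ for states $\rho,\sigma$. -/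

import Mathlib

open Matrix Topology Asymptotics
open scoped MatrixOrder ComplexOrder

noncomputable section

namespace CovariantCodes

variable {A B : Type*} [Fintype A] [Fintype B] [DecidableEq A] [DecidableEq B]

/-- The difference between the largest and the smallest eigenvalue of a Hermitian matrix. -/
def spread (M : Matrix A A ℂ) : ℝ :=
  sSup (spectrum ℝ M) - sInf (spectrum ℝ M)

/-- A density matrix: positive semidefinite with unit trace. -/
def IsState (ρ : Matrix A A ℂ) : Prop :=
  ρ.PosSemidef ∧ ρ.trace = 1

/-- The (root) fidelity `Tr √(√ρ σ √ρ)`. -/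
def fidelity (ρ σ : Matrix A A ℂ) : ℝ :=
  (CFC.sqrt (CFC.sqrt ρ * σ * CFC.sqrt ρ)).trace.re

/-- The purified distance `√(1 - f(ρ, σ)²)` between states. -/
def purifiedDist (ρ σ : Matrix A A ℂ) : ℝ :=
  √(1 - fidelity ρ σ ^ 2)

/-- The map `Φ ⊗ id` on matrices over `A ⊗ R`: apply `Φ` to each of the `R`-indexed blocks. -/
def ampliation (Φ : Matrix A A ℂ →ₗ[ℂ] Matrix B B ℂ) (R : Type*)
    (X : Matrix (A × R) (A × R) ℂ) : Matrix (B × R) (B × R) ℂ :=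
  Matrix.of fun p q => Φ (Matrix.of fun a a' => X (a, p.2) (a', q.2)) p.1 q.1

/-- Quantum channels: completely positive trace-preserving linear maps. -/
structure IsChannel (Φ : Matrix A A ℂ →ₗ[ℂ] Matrix B B ℂ) : Prop where
  completelyPositive : ∀ (n : ℕ) (X : Matrix (A × Fin n) (A × Fin n) ℂ),
    X.PosSemidef → (ampliation Φ (Fin n) X).PosSemidef
  tracePreserving : ∀ X : Matrix A A ℂ, (Φ X).trace = X.trace

/-- The channel purified distance: the purified distance between `(Φ₁ ⊗ id)(ρ)` and
`(Φ₂ ⊗ id)(ρ)`, maximized over all joint states `ρ` of the input and a finite-dimensional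
reference system. -/
def channelDist (Φ₁ Φ₂ : Matrix A A ℂ →ₗ[ℂ] Matrix B B ℂ) : ℝ :=
  sSup {x : ℝ | ∃ (n : ℕ) (ρ : Matrix (A × Fin n) (A × Fin n) ℂ), IsState ρ ∧
    x = purifiedDist (ampliation Φ₁ (Fin n) ρ) (ampliation Φ₂ (Fin n) ρ)}

/-- The map `X ↦ M X M†`. -/
def conjMap (M : Matrix B A ℂ) : Matrix A A ℂ →ₗ[ℂ] Matrix B B ℂ where
  toFun X := M * X * Mᴴ
  map_add' X Y := by rw [Matrix.mul_add, Matrix.add_mul]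
  map_smul' c X := by simp

/-- The map `X ↦ ∑ᵢ Kᵢ X Kᵢ†` with Kraus operators `Kᵢ`. -/
def krausMap {ι : Type*} [Fintype ι] (K : ι → Matrix B A ℂ) :
    Matrix A A ℂ →ₗ[ℂ] Matrix B B ℂ :=
  ∑ i, conjMap (K i)

/-- The unitary channel `X ↦ U X U†` with `U = exp(-iθH)`. -/
def evolution (H : Matrix A A ℂ) (θ : ℝ) : Matrix A A ℂ →ₗ[ℂ] Matrix A A ℂ :=
  conjMap (NormedSpace.exp ((-(Complex.I * (θ : ℂ))) • H))

variable {L S ι : Type*} [Fintype L] [Fintype S] [Fintype ι]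
  [DecidableEq L] [DecidableEq S] [DecidableEq ι]

/-- The global covariance violation of the encoding `E` with respect to the logical Hamiltonian
`HL` and the physical Hamiltonian `HS`. -/
def globalViolation (HL : Matrix L L ℂ) (HS : Matrix S S ℂ)
    (E : Matrix L L ℂ →ₗ[ℂ] Matrix S S ℂ) : ℝ :=
  ⨆ θ : ℝ, channelDist (evolution HS θ ∘ₗ E) (E ∘ₗ evolution HL θ)

/-- The QEC inaccuracy of the encoding `E` under the noise `N`, optimized over all recovery
channels. -/
def qecInaccuracy (N : Matrix S S ℂ →ₗ[ℂ] Matrix S S ℂ)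
    (E : Matrix L L ℂ →ₗ[ℂ] Matrix S S ℂ) : ℝ :=
  sInf {x : ℝ | ∃ R : Matrix S S ℂ →ₗ[ℂ] Matrix L L ℂ, IsChannel R ∧
    x = channelDist (R ∘ₗ N ∘ₗ E) LinearMap.id}

/-- The minimal spread of a Hermitian matrix `h` with `H = ∑ᵢⱼ hᵢⱼ Kᵢ† Kⱼ`. -/
def minKrausSpread (H : Matrix S S ℂ) (K : ι → Matrix S S ℂ) : ℝ :=
  sInf {x : ℝ | ∃ h : Matrix ι ι ℂ, h.IsHermitian ∧
    H = ∑ i, ∑ j, h i j • ((K i)ᴴ * K j) ∧ x = spread h}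

end CovariantCodes

end

/-!
The function is `ℓ y = y - y²`. Let `v₀`, `v₁` be unit eigenvectors of `HL` for its largest and
smallest eigenvalues `λ₀`, `λ₁`, and let the *charge fluctuation* `χ` be the difference of the
expectations of `HS` in the states `W v₀` and `W v₁`. Both halves of the proof use a single input
to the channels, the entangled vector `(v₀ ⊗ e₀ + v₁ ⊗ e₁) / √2`; the purified distance of the
outputs is computed from the fidelity with a pure state, `f(ρ, ψψ†)² = ⟨ψ, ρ ψ⟩`.

*Recoverability bounds the charge fluctuation*: `χ ≤ 2 ε 𝔍` (`charge_fluctuation_le`). Write a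
recovery channel in Kraus form with operators `Rₖ`. By `HS = ∑ hᵢⱼ Kᵢ† Kⱼ`, `χ / 2` is the
expectation of `h ⊗ (±1)` in the unit vector `Ψ` with blocks `Rₖ Kᵢ W vₐ / √2`, where the sign
reads off `a`. If the recovery is good, `Ψ` is close to its projection `T` to the vectors with
blocks `vₐ ⊗ c / √2`, and in `T` this expectation vanishes. For an observable of norm `m` the two
expectations differ by at most `m ‖Ψ - T‖ ‖Ψ + T‖ ≤ 2 m √(1 - ‖T‖²)`, where `‖T‖²` is the
entanglement fidelity; after centering `h`, `m` is half the spread of `h` (`sum_quadForm_sub_le`).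

*Covariance forces charge conservation*: `ΔHL - χ ≤ 2 q ΔHS` for some `q ≤ 1/4` with `2 q (1 - q) ≤
δ²` (`exists_spread_sub_charge_fluctuation_le`). The overlap of the two outputs at time `θ` is the
characteristic function at `θ` of the random variable `λₐ - μ`, where `a` is uniform on `{0, 1}`
and `μ` is distributed as the outcome of measuring `HS` in `W vₐ`. Its squared modulus is at least
`1 - δ²` for every `θ`. The time average of the squared modulus is the sum of the squares of the
weights of the atoms, so some atom carries a weight `1 - q` with `(1 - q)² + q² ≥ 1 - δ²`
(`exists_atom_of_norm_sq_sum_exp`). Off this atom, `μ` moves the mean by at most `ΔHS`. It is the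
factor `2` in `2 q (1 - q)`, lost if the largest weight itself were used, that gives `ℓ` the
leading coefficient `1`.

With `y² = (ΔHL - 2 ε 𝔍) / ΔHS` the two bounds give `y² ≤ 2 q`, hence `δ² ≥ y² (1 - y² / 2)`.
-/

namespace CovariantCodes

/-! ### Spectral decomposition of quadratic forms -/

section

variable {A B : Type*} [Fintype A] [Fintype B]

theorem star_dotProduct_self (x : A → ℂ) :
    star x ⬝ᵥ x = ((∑ i, ‖x i‖ ^ 2 : ℝ) : ℂ) := by
  simp only [dotProduct, Pi.star_apply, RCLike.star_def, Complex.conj_mul']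
  push_cast
  rfl

theorem star_mulVec_dotProduct_mulVec (M N : Matrix B A ℂ) (x y : A → ℂ) :
    star (M *ᵥ x) ⬝ᵥ (N *ᵥ y) = star x ⬝ᵥ ((Mᴴ * N) *ᵥ y) := by
  rw [star_mulVec, ← dotProduct_mulVec, mulVec_mulVec]

/-- The squared modulus of the coefficient of `x` along the `s`-th vector of the chosen eigenbasis
of `H`. -/
noncomputable def eigenWeight [DecidableEq A] {H : Matrix A A ℂ} (hH : H.IsHermitian) (x : A → ℂ)
    (s : A) : ℝ :=
  ‖((hH.eigenvectorUnitary : Matrix A A ℂ)ᴴ *ᵥ x) s‖ ^ 2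

theorem eigenWeight_nonneg [DecidableEq A] {H : Matrix A A ℂ} (hH : H.IsHermitian) (x : A → ℂ)
    (s : A) :
    0 ≤ eigenWeight hH x s := sq_nonneg _

theorem quadForm_conj_diagonal [DecidableEq A] (U : Matrix A A ℂ) (f : A → ℂ) (x : A → ℂ) :
    star x ⬝ᵥ ((U * diagonal f * Uᴴ) *ᵥ x) = ∑ s, f s * ((‖(Uᴴ *ᵥ x) s‖ ^ 2 : ℝ) : ℂ) := by
  have h : U * diagonal f * Uᴴ = (Uᴴ)ᴴ * (diagonal f * Uᴴ) := by
    rw [conjTranspose_conjTranspose, Matrix.mul_assoc]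
  rw [h, ← star_mulVec_dotProduct_mulVec, ← mulVec_mulVec]
  simp only [dotProduct, mulVec_diagonal, Pi.star_apply, RCLike.star_def]
  refine Finset.sum_congr rfl fun s _ => ?_
  push_cast
  rw [← Complex.conj_mul']
  ring

theorem eigenvectorUnitary_mul_conjTranspose [DecidableEq A] {H : Matrix A A ℂ}
    (hH : H.IsHermitian) :
    (hH.eigenvectorUnitary : Matrix A A ℂ) * (hH.eigenvectorUnitary : Matrix A A ℂ)ᴴ = 1 :=
  Unitary.coe_mul_star_self hH.eigenvectorUnitary

theorem eq_conj_diagonal_eigenvalues [DecidableEq A] {H : Matrix A A ℂ} (hH : H.IsHermitian) :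
    H = (hH.eigenvectorUnitary : Matrix A A ℂ) * diagonal (fun s => (hH.eigenvalues s : ℂ)) *
      (hH.eigenvectorUnitary : Matrix A A ℂ)ᴴ := by
  conv_lhs => rw [hH.spectral_theorem]
  rfl

theorem exp_smul_eq_conj_diagonal [DecidableEq A] {H : Matrix A A ℂ} (hH : H.IsHermitian) (c : ℂ) :
    NormedSpace.exp (c • H) = (hH.eigenvectorUnitary : Matrix A A ℂ) *
      diagonal (fun s => Complex.exp (c * hH.eigenvalues s)) *
      (hH.eigenvectorUnitary : Matrix A A ℂ)ᴴ := by
  set U := (hH.eigenvectorUnitary : Matrix A A ℂ) with hU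
  have h1 : U * Uᴴ = 1 := eigenvectorUnitary_mul_conjTranspose hH
  have hinv : U⁻¹ = Uᴴ := Matrix.inv_eq_right_inv h1
  have hunit : IsUnit U := IsUnit.of_mul_eq_one _ h1
  have h2 : c • H = U * diagonal (fun s => c * (hH.eigenvalues s : ℂ)) * U⁻¹ := by
    conv_lhs => rw [eq_conj_diagonal_eigenvalues hH]
    rw [hinv, ← hU, ← Matrix.smul_mul, ← Matrix.mul_smul, ← diagonal_smul]
    rfl
  rw [h2, Matrix.exp_conj _ _ hunit, Matrix.exp_diagonal, hinv]
  congr 3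
  ext s
  rw [Pi.coe_exp, Complex.exp_eq_exp_ℂ]

theorem sum_eigenWeight [DecidableEq A] {H : Matrix A A ℂ} (hH : H.IsHermitian) (x : A → ℂ) :
    ∑ s, eigenWeight hH x s = ∑ i, ‖x i‖ ^ 2 := by
  have h := quadForm_conj_diagonal (hH.eigenvectorUnitary : Matrix A A ℂ) (fun _ => 1) x
  rw [show (diagonal fun _ => 1 : Matrix A A ℂ) = 1 from diagonal_one, Matrix.mul_one,
    eigenvectorUnitary_mul_conjTranspose, Matrix.one_mulVec, star_dotProduct_self] at h
  simp only [one_mul] at h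
  exact_mod_cast h.symm

theorem quadForm_eq_sum [DecidableEq A] {H : Matrix A A ℂ} (hH : H.IsHermitian) (x : A → ℂ) :
    star x ⬝ᵥ (H *ᵥ x) = ((∑ s, hH.eigenvalues s * eigenWeight hH x s : ℝ) : ℂ) := by
  conv_lhs => rw [eq_conj_diagonal_eigenvalues hH]
  rw [quadForm_conj_diagonal]
  push_cast [eigenWeight]
  rfl

theorem quadForm_exp_eq_sum [DecidableEq A] {H : Matrix A A ℂ} (hH : H.IsHermitian) (c : ℂ)
    (x : A → ℂ) :
    star x ⬝ᵥ (NormedSpace.exp (c • H) *ᵥ x) =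
      ∑ s, Complex.exp (c * hH.eigenvalues s) * (eigenWeight hH x s : ℂ) := by
  rw [exp_smul_eq_conj_diagonal hH, quadForm_conj_diagonal]
  rfl

theorem exp_smul_mulVec_eigenvector [DecidableEq A] {H : Matrix A A ℂ} (hH : H.IsHermitian)
    (c : ℂ) (s : A) :
    NormedSpace.exp (c • H) *ᵥ (⇑(hH.eigenvectorBasis s) : A → ℂ) =
      Complex.exp (c * hH.eigenvalues s) • (⇑(hH.eigenvectorBasis s) : A → ℂ) := by
  rw [exp_smul_eq_conj_diagonal hH, ← mulVec_mulVec, ← star_eq_conjTranspose,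
    hH.star_eigenvectorUnitary_mulVec, ← mulVec_mulVec, diagonal_mulVec_single, mul_one,
    ← hH.eigenvectorUnitary_mulVec, ← mulVec_smul]
  congr 1
  ext j
  by_cases hj : j = s
  · subst hj; simp
  · simp [hj]

theorem sum_norm_sq_eigenvector [DecidableEq A] {H : Matrix A A ℂ} (hH : H.IsHermitian) (s : A) :
    ∑ i, ‖hH.eigenvectorBasis s i‖ ^ 2 = 1 := by
  rw [← EuclideanSpace.norm_sq_eq, hH.eigenvectorBasis.orthonormal.1 s, one_pow]

/-! ### The spread of a Hermitian matrix -/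

theorem eigenvalues_le_sSup [DecidableEq A] {H : Matrix A A ℂ} (hH : H.IsHermitian) (s : A) :
    hH.eigenvalues s ≤ sSup (spectrum ℝ H) :=
  le_csSup H.finite_real_spectrum.bddAbove (hH.eigenvalues_mem_spectrum_real s)

theorem sInf_le_eigenvalues [DecidableEq A] {H : Matrix A A ℂ} (hH : H.IsHermitian) (s : A) :
    sInf (spectrum ℝ H) ≤ hH.eigenvalues s :=
  csInf_le H.finite_real_spectrum.bddBelow (hH.eigenvalues_mem_spectrum_real s)

theorem eigenvalues_sub_le_spread [DecidableEq A] {H : Matrix A A ℂ} (hH : H.IsHermitian)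
    (s t : A) :
    hH.eigenvalues s - hH.eigenvalues t ≤ spread H :=
  sub_le_sub (eigenvalues_le_sSup hH s) (sInf_le_eigenvalues hH t)

theorem exists_eigenvalues_sub_eq_spread [DecidableEq A] [Nonempty A] {H : Matrix A A ℂ}
    (hH : H.IsHermitian) :
    ∃ s t, hH.eigenvalues s - hH.eigenvalues t = spread H := by
  have hne : (spectrum ℝ H).Nonempty :=
    ⟨_, hH.eigenvalues_mem_spectrum_real (Classical.arbitrary A)⟩
  have h1 := hne.csSup_mem H.finite_real_spectrum
  have h2 := hne.csInf_mem H.finite_real_spectrum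
  rw [hH.spectrum_real_eq_range_eigenvalues] at h1 h2
  obtain ⟨s, hs⟩ := h1
  obtain ⟨t, ht⟩ := h2
  refine ⟨s, t, ?_⟩
  rw [hs, ht, spread, hH.spectrum_real_eq_range_eigenvalues]

theorem spread_nonneg [DecidableEq A] {H : Matrix A A ℂ} (hH : H.IsHermitian) : 0 ≤ spread H := by
  rcases isEmpty_or_nonempty A with h | h
  · rw [spread, hH.spectrum_real_eq_range_eigenvalues, Set.range_eq_empty, Real.sSup_empty,
      Real.sInf_empty, sub_zero]
  · simpa using eigenvalues_sub_le_spread hH (Classical.arbitrary A) (Classical.arbitrary A)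

/-- Around the midpoint `c` of the spectrum, the quadratic form of `H` is bounded by half the
spread. -/
theorem exists_abs_quadForm_sub_le [DecidableEq A] {H : Matrix A A ℂ} (hH : H.IsHermitian) :
    ∃ c : ℝ, ∀ x : A → ℂ,
      |(star x ⬝ᵥ (H *ᵥ x)).re - c * ∑ i, ‖x i‖ ^ 2| ≤ spread H / 2 * ∑ i, ‖x i‖ ^ 2 := by
  refine ⟨(sSup (spectrum ℝ H) + sInf (spectrum ℝ H)) / 2, fun x => ?_⟩
  rw [quadForm_eq_sum hH, Complex.ofReal_re, ← sum_eigenWeight hH, Finset.mul_sum, Finset.mul_sum,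
    ← Finset.sum_sub_distrib]
  refine (Finset.abs_sum_le_sum_abs _ _).trans (Finset.sum_le_sum fun s _ => ?_)
  rw [← sub_mul, abs_mul, abs_of_nonneg (eigenWeight_nonneg hH x s)]
  refine mul_le_mul_of_nonneg_right ?_ (eigenWeight_nonneg hH x s)
  have h1 := eigenvalues_le_sSup hH s
  have h2 := sInf_le_eigenvalues hH s
  rw [spread, abs_le]
  constructor <;> linarith

/-! ### Fidelity with a pure state -/

theorem sum_norm_sq_eq_zero_iff (x : A → ℂ) : ∑ i, ‖x i‖ ^ 2 = 0 ↔ x = 0 := by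
  rw [Finset.sum_eq_zero_iff_of_nonneg fun i _ => sq_nonneg _]
  simp [funext_iff]

/-- The square root of `x x†` is `x x† / ‖x‖`; the case `x = 0` uses `0⁻¹ = 0`. -/
theorem trace_sqrt_vecMulVec_star [DecidableEq A] (x : A → ℂ) :
    (CFC.sqrt (vecMulVec x (star x))).trace.re = √(∑ i, ‖x i‖ ^ 2) := by
  set r := ∑ i, ‖x i‖ ^ 2 with hr
  have hr0 : 0 ≤ r := Finset.sum_nonneg fun i _ => sq_nonneg _
  have hsqrt : CFC.sqrt (vecMulVec x (star x)) =
      (((√r)⁻¹ : ℝ) : ℂ) • vecMulVec x (star x) := by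
    refine CFC.sqrt_unique ?_ ?_
    · rw [Matrix.smul_mul, Matrix.mul_smul, vecMulVec_mul_vecMulVec, star_dotProduct_self, ← hr,
        smul_smul]
      rcases eq_or_ne r 0 with h0 | h0
      · rw [(sum_norm_sq_eq_zero_iff x).1 (hr ▸ h0)]
        simp
      · rw [vecMulVec_smul, smul_smul, ← Complex.ofReal_mul, ← Complex.ofReal_mul]
        have : (√r)⁻¹ * (√r)⁻¹ * r = 1 := by
          rw [← mul_inv, Real.mul_self_sqrt hr0, inv_mul_cancel₀ h0]
        rw [this, Complex.ofReal_one, one_smul]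
    · refine Matrix.PosSemidef.nonneg ((posSemidef_vecMulVec_self_star x).smul ?_)
      exact_mod_cast inv_nonneg.2 (Real.sqrt_nonneg r)
  rw [hsqrt, trace_smul, trace_vecMulVec, dotProduct_comm, star_dotProduct_self, ← hr, smul_eq_mul,
    ← Complex.ofReal_mul, Complex.ofReal_re, inv_mul_eq_div, Real.div_sqrt]

theorem fidelity_vecMulVec_star [DecidableEq A] {ρ : Matrix A A ℂ} (hρ : ρ.PosSemidef) (x : A → ℂ) :
    fidelity ρ (vecMulVec x (star x)) = √((star x ⬝ᵥ (ρ *ᵥ x)).re) := by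
  have hs : (CFC.sqrt ρ)ᴴ = CFC.sqrt ρ := (CFC.sqrt_nonneg ρ).posSemidef.isHermitian
  have h : CFC.sqrt ρ * vecMulVec x (star x) * CFC.sqrt ρ =
      vecMulVec (CFC.sqrt ρ *ᵥ x) (star (CFC.sqrt ρ *ᵥ x)) := by
    rw [mul_vecMulVec, vecMulVec_mul, star_mulVec, hs]
  rw [fidelity, h, trace_sqrt_vecMulVec_star]
  congr 1
  have h2 := star_mulVec_dotProduct_mulVec (CFC.sqrt ρ) (CFC.sqrt ρ) x x
  rw [hs, CFC.sqrt_mul_sqrt_self ρ hρ.nonneg, star_dotProduct_self] at h2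
  rw [← h2, Complex.ofReal_re]

end

/-! ### Kraus representations -/

section

variable {A B C R ι κ : Type*} [Fintype A] [Fintype ι] [Fintype κ]

theorem krausMap_apply (K : ι → Matrix B A ℂ) (X : Matrix A A ℂ) :
    krausMap K X = ∑ i, K i * X * (K i)ᴴ := by
  simp [krausMap, conjMap]

theorem krausMap_comp_conjMap [Fintype B] (K : ι → Matrix C B ℂ) (W : Matrix B A ℂ) :
    krausMap K ∘ₗ conjMap W = krausMap fun i => K i * W := by
  ext1 X
  simp [krausMap_apply, conjMap, Matrix.mul_assoc, conjTranspose_mul]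

theorem krausMap_comp_krausMap [Fintype B] (M : κ → Matrix C B ℂ) (K : ι → Matrix B A ℂ) :
    krausMap M ∘ₗ krausMap K = krausMap fun p : κ × ι => M p.1 * K p.2 := by
  ext1 X
  simp [krausMap_apply, Matrix.mul_assoc, conjTranspose_mul, Fintype.sum_prod_type_right]

theorem conjMap_comp_conjMap [Fintype B] (M : Matrix C B ℂ) (W : Matrix B A ℂ) :
    conjMap M ∘ₗ conjMap W = conjMap (M * W) := by
  ext1 X
  simp [conjMap, Matrix.mul_assoc, conjTranspose_mul]

theorem conjMap_eq_krausMap (M : Matrix B A ℂ) : conjMap M = krausMap fun _ : Unit => M := by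
  simp [krausMap]

theorem conjMap_one [DecidableEq A] : conjMap (1 : Matrix A A ℂ) = LinearMap.id := by
  ext1 X
  simp [conjMap]

theorem trace_krausMap [Fintype B] (K : ι → Matrix B A ℂ) (X : Matrix A A ℂ) :
    (krausMap K X).trace = ((∑ i, (K i)ᴴ * K i) * X).trace := by
  rw [krausMap_apply, trace_sum, Matrix.sum_mul, trace_sum]
  refine Finset.sum_congr rfl fun i _ => ?_
  rw [trace_mul_comm, ← Matrix.mul_assoc]

theorem ampliation_krausMap (K : ι → Matrix B A ℂ) [Fintype R] [DecidableEq R]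
    (X : Matrix (A × R) (A × R) ℂ) :
    ampliation (krausMap K) R X =
      ∑ i, kronecker (K i) (1 : Matrix R R ℂ) * X * (kronecker (K i) (1 : Matrix R R ℂ))ᴴ := by
  ext ⟨b, r⟩ ⟨b', r'⟩
  simp only [ampliation, of_apply, krausMap_apply, Matrix.sum_apply]
  refine Finset.sum_congr rfl fun i _ => ?_
  simp [Matrix.mul_apply, Fintype.sum_prod_type, one_apply, Finset.sum_mul, kroneckerMap_apply,
    apply_ite]

theorem isChannel_krausMap [Fintype B] [DecidableEq A] {K : ι → Matrix B A ℂ}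
    (hK : ∑ i, (K i)ᴴ * K i = 1) : IsChannel (krausMap K) where
  completelyPositive n X hX := by
    rw [ampliation_krausMap]
    exact posSemidef_sum _ fun i _ => hX.mul_mul_conjTranspose_same _
  tracePreserving X := by rw [trace_krausMap, hK, Matrix.one_mul]

theorem eq_one_of_trace_mul_eq [DecidableEq A] {M : Matrix A A ℂ}
    (h : ∀ X : Matrix A A ℂ, (M * X).trace = X.trace) : M = 1 := by
  ext i j
  have := h (single j i 1)
  rw [trace_mul_comm, trace_single_mul, one_smul] at this
  rw [this]
  rcases eq_or_ne i j with rfl | hij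
  · simp
  · rw [one_apply_ne hij, trace_single_eq_of_ne _ _ _ hij.symm]

/-- **Kraus representation** of a channel; the operators are read off a factorization `Bᴴ * B`
of the Choi matrix. -/
theorem IsChannel.exists_krausMap [Fintype B] [DecidableEq A] [DecidableEq B]
    {Φ : Matrix A A ℂ →ₗ[ℂ] Matrix B B ℂ} (hΦ : IsChannel Φ) :
    ∃ K : B × Fin (Fintype.card A) → Matrix B A ℂ,
      Φ = krausMap K ∧ ∑ i, (K i)ᴴ * K i = 1 := by
  let e := Fintype.equivFin A
  let ω : A × Fin (Fintype.card A) → ℂ := fun p => if e p.1 = p.2 then 1 else 0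
  have hpos := hΦ.completelyPositive _ _ (posSemidef_vecMulVec_self_star ω)
  obtain ⟨D, hD⟩ := CStarAlgebra.nonneg_iff_eq_star_mul_self.1 hpos.nonneg
  have hunit (a a' : A) (b b' : B) :
      Φ (single a a' 1) b b' = ∑ k, star (D k (b, e a)) * D k (b', e a') := by
    have h1 := congr_fun₂ hD (b, e a) (b', e a')
    simp only [ampliation, of_apply, mul_apply, star_apply] at h1
    rw [← h1]
    refine congr_arg (fun Y => Φ Y b b') ?_
    ext x y
    simp only [ω, vecMulVec_apply, single_apply, of_apply, Pi.star_apply,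
      EmbeddingLike.apply_eq_iff_eq]
    by_cases hx : a = x <;> by_cases hy : a' = y <;> simp [hx, hy, Ne.symm]
  let K : B × Fin (Fintype.card A) → Matrix B A ℂ := fun k => of fun b a => star (D k (b, e a))
  have hK : Φ = krausMap K := by
    refine Matrix.ext_linearMap ℂ fun a a' => LinearMap.ext_ring ?_
    ext b b'
    change Φ (single a a' 1) b b' = krausMap K (single a a' 1) b b'
    rw [hunit, krausMap_apply, Matrix.sum_apply]
    refine Finset.sum_congr rfl fun k _ => ?_
    simp [K, mul_apply, single_apply, ite_and]
  refine ⟨K, hK, eq_one_of_trace_mul_eq fun X => ?_⟩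
  rw [← trace_krausMap, ← hK, hΦ.tracePreserving]

/-- The channel that discards its input and prepares a fixed basis state. -/
theorem exists_isChannel (A B : Type*) [Fintype A] [Fintype B] [DecidableEq A] [DecidableEq B]
    [Nonempty B] : ∃ Φ : Matrix A A ℂ →ₗ[ℂ] Matrix B B ℂ, IsChannel Φ := by
  refine ⟨_, isChannel_krausMap (K := fun a : A => single (Classical.arbitrary B) a 1) ?_⟩
  ext i j
  simp [Matrix.sum_apply, single_apply, one_apply, ite_and]

/-! ### Kraus maps on entangled pure inputs -/

/-- The vector `(v₀ ⊗ e₀ + v₁ ⊗ e₁) / √2`, entangled with a reference qubit indexed by `Fin 2`. -/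
noncomputable def bellVec (v : Fin 2 → A → ℂ) : A × Fin 2 → ℂ :=
  fun p => ((√2)⁻¹ : ℝ) * v p.2 p.1

theorem kronecker_one_mulVec_bellVec (M : Matrix B A ℂ) (v : Fin 2 → A → ℂ) :
    kronecker M (1 : Matrix (Fin 2) (Fin 2) ℂ) *ᵥ bellVec v = bellVec fun a => M *ᵥ v a := by
  ext ⟨b, r⟩
  simp [bellVec, mulVec, dotProduct, Fintype.sum_prod_type, one_apply, Finset.mul_sum,
    mul_left_comm]

theorem star_bellVec_dotProduct_bellVec (u v : Fin 2 → A → ℂ) :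
    star (bellVec u) ⬝ᵥ bellVec v = (∑ a, star (u a) ⬝ᵥ v a) / 2 := by
  have h : ((√2 : ℝ) : ℂ)⁻¹ * ((√2 : ℝ) : ℂ)⁻¹ = 1 / 2 := by
    rw [← mul_inv, ← Complex.ofReal_mul, Real.mul_self_sqrt (by norm_num)]
    norm_num
  simp only [dotProduct, bellVec, Fintype.sum_prod_type_right, Pi.star_apply, Finset.sum_div,
    star_mul', RCLike.star_def, Complex.conj_ofReal]
  push_cast
  refine Finset.sum_congr rfl fun a _ => Finset.sum_congr rfl fun i _ => ?_
  linear_combination (starRingEnd ℂ) (u a i) * v a i * h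

theorem isState_vecMulVec_bellVec {v : Fin 2 → A → ℂ} (hv : ∀ a, ∑ i, ‖v a i‖ ^ 2 = 1) :
    IsState (vecMulVec (bellVec v) (star (bellVec v))) := by
  refine ⟨posSemidef_vecMulVec_self_star _, ?_⟩
  rw [trace_vecMulVec, dotProduct_comm, star_bellVec_dotProduct_bellVec]
  simp [star_dotProduct_self, hv]

theorem ampliation_krausMap_bellVec (K : ι → Matrix B A ℂ) (v : Fin 2 → A → ℂ) :
    ampliation (krausMap K) (Fin 2) (vecMulVec (bellVec v) (star (bellVec v))) =
      ∑ i, vecMulVec (bellVec fun a => K i *ᵥ v a) (star (bellVec fun a => K i *ᵥ v a)) := by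
  rw [ampliation_krausMap]
  refine Finset.sum_congr rfl fun i _ => ?_
  rw [mul_vecMulVec, vecMulVec_mul, ← star_mulVec, kronecker_one_mulVec_bellVec]

theorem ampliation_conjMap_bellVec (M : Matrix B A ℂ) (v : Fin 2 → A → ℂ) :
    ampliation (conjMap M) (Fin 2) (vecMulVec (bellVec v) (star (bellVec v))) =
      vecMulVec (bellVec fun a => M *ᵥ v a) (star (bellVec fun a => M *ᵥ v a)) := by
  rw [conjMap_eq_krausMap, ampliation_krausMap_bellVec, Fintype.sum_unique]

theorem quadForm_vecMulVec_star (x y : A → ℂ) :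
    star y ⬝ᵥ (vecMulVec x (star x) *ᵥ y) = ((‖star y ⬝ᵥ x‖ ^ 2 : ℝ) : ℂ) := by
  rw [vecMulVec_mulVec, dotProduct_smul, op_smul_eq_mul, star_dotProduct x y]
  simp [Complex.mul_conj']

/-- The output of `X ↦ M X M†` is pure, so its fidelity with the output of the Kraus map is an
overlap. -/
theorem purifiedDist_krausMap_conjMap_bellVec [Fintype B] [DecidableEq B] (K : ι → Matrix B A ℂ)
    (M : Matrix B A ℂ) (v : Fin 2 → A → ℂ) :
    purifiedDist (ampliation (krausMap K) (Fin 2) (vecMulVec (bellVec v) (star (bellVec v))))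
        (ampliation (conjMap M) (Fin 2) (vecMulVec (bellVec v) (star (bellVec v)))) =
      √(1 - ∑ i, ‖(∑ a, star (M *ᵥ v a) ⬝ᵥ (K i *ᵥ v a)) / 2‖ ^ 2) := by
  rw [ampliation_conjMap_bellVec, ampliation_krausMap_bellVec]
  have hpos : (∑ i, vecMulVec (bellVec fun a => K i *ᵥ v a)
      (star (bellVec fun a => K i *ᵥ v a))).PosSemidef :=
    posSemidef_sum _ fun i _ => posSemidef_vecMulVec_self_star _
  rw [purifiedDist, fidelity_vecMulVec_star hpos, sum_mulVec, dotProduct_sum]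
  simp only [quadForm_vecMulVec_star, star_bellVec_dotProduct_bellVec]
  rw [← Complex.ofReal_sum, Complex.ofReal_re,
    Real.sq_sqrt (Finset.sum_nonneg fun i _ => sq_nonneg _)]

/-! ### The channel purified distance -/

theorem purifiedDist_le_one [DecidableEq A] (ρ σ : Matrix A A ℂ) : purifiedDist ρ σ ≤ 1 := by
  rw [purifiedDist, Real.sqrt_le_one]
  linarith [sq_nonneg (fidelity ρ σ)]

theorem channelDist_nonneg [Fintype B] [DecidableEq A] [DecidableEq B]
    (Φ₁ Φ₂ : Matrix A A ℂ →ₗ[ℂ] Matrix B B ℂ) : 0 ≤ channelDist Φ₁ Φ₂ := by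
  refine Real.sSup_nonneg ?_
  rintro x ⟨n, ρ, -, rfl⟩
  exact Real.sqrt_nonneg _

theorem channelDist_le_one [Fintype B] [DecidableEq A] [DecidableEq B]
    (Φ₁ Φ₂ : Matrix A A ℂ →ₗ[ℂ] Matrix B B ℂ) : channelDist Φ₁ Φ₂ ≤ 1 := by
  refine Real.sSup_le ?_ zero_le_one
  rintro x ⟨n, ρ, -, rfl⟩
  exact purifiedDist_le_one _ _

theorem purifiedDist_le_channelDist [Fintype B] [DecidableEq A] [DecidableEq B]
    (Φ₁ Φ₂ : Matrix A A ℂ →ₗ[ℂ] Matrix B B ℂ) {n : ℕ} {ρ : Matrix (A × Fin n) (A × Fin n) ℂ}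
    (hρ : IsState ρ) :
    purifiedDist (ampliation Φ₁ (Fin n) ρ) (ampliation Φ₂ (Fin n) ρ) ≤ channelDist Φ₁ Φ₂ := by
  refine le_csSup ⟨1, ?_⟩ ⟨n, ρ, hρ, rfl⟩
  rintro x ⟨n, ρ, -, rfl⟩
  exact purifiedDist_le_one _ _

/-- The squared overlap of the outputs on a maximally entangled input is at least `1 - P²`. -/
theorem one_sub_channelDist_sq_le [Fintype B] [DecidableEq A] [DecidableEq B] (K : ι → Matrix B A ℂ)
    (M : Matrix B A ℂ) {v : Fin 2 → A → ℂ} (hv : ∀ a, ∑ i, ‖v a i‖ ^ 2 = 1) :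
    1 - channelDist (krausMap K) (conjMap M) ^ 2 ≤
      ∑ i, ‖(∑ a, star (M *ᵥ v a) ⬝ᵥ (K i *ᵥ v a)) / 2‖ ^ 2 := by
  have h := purifiedDist_le_channelDist (krausMap K) (conjMap M) (isState_vecMulVec_bellVec hv)
  rw [purifiedDist_krausMap_conjMap_bellVec] at h
  linarith [(Real.sqrt_le_left (channelDist_nonneg _ _)).1 h]

end

/-! ### Time averages of trigonometric sums -/

/-- A lower bound on a trigonometric sum holds for its mean value, the sum of the constant terms:
the primitive of the remaining terms is bounded. -/
theorem le_sum_const_of_le_sum_cos {J : Type*} [Fintype J] (c ω : J → ℝ) (b : ℝ)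
    (h : ∀ θ : ℝ, b ≤ ∑ j, c j * Real.cos (θ * ω j)) :
    b ≤ ∑ j, if ω j = 0 then c j else 0 := by
  set m := ∑ j, if ω j = 0 then c j else 0 with hm
  let r : J → ℝ → ℝ := fun j θ => if ω j = 0 then c j * θ else c j * (Real.sin (θ * ω j) / ω j)
  have hr (j : J) (θ : ℝ) : HasDerivAt (r j) (c j * Real.cos (θ * ω j)) θ := by
    by_cases h0 : ω j = 0
    · simpa [r, h0] using (hasDerivAt_id θ).const_mul (c j)
    · have h1 := (((hasDerivAt_id θ).mul_const (ω j)).sin.div_const (ω j)).const_mul (c j)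
      simp only [id, one_mul, mul_div_cancel_right₀ _ h0] at h1
      simpa [r, h0] using h1
  have hmono : Monotone fun θ => ∑ j, r j θ - b * θ := by
    refine monotone_of_hasDerivAt_nonneg
      (f' := fun θ => ∑ j, c j * Real.cos (θ * ω j) - b * 1) (fun θ => ?_) fun θ => ?_
    · exact (HasDerivAt.fun_sum fun j _ => hr j θ).sub ((hasDerivAt_id θ).const_mul b)
    · simpa using h θ
  set D := ∑ j, |c j / ω j| with hD
  have hD0 : 0 ≤ D := Finset.sum_nonneg fun j _ => abs_nonneg _
  have hbound (T : ℝ) (hT : 0 < T) : b * T ≤ m * T + D := by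
    have h1 := hmono hT.le
    have h2 : ∑ j, r j 0 = 0 := Finset.sum_eq_zero fun j _ => by simp [r]
    have h3 : ∑ j, r j T ≤ m * T + D := by
      rw [hm, hD, Finset.sum_mul, ← Finset.sum_add_distrib]
      refine Finset.sum_le_sum fun j _ => ?_
      by_cases h0 : ω j = 0
      · simp [r, h0]
      · have h4 : c j * (Real.sin (T * ω j) / ω j) = c j / ω j * Real.sin (T * ω j) := by ring
        simp only [r, h0, if_false, zero_mul, zero_add, h4]
        refine (le_abs_self _).trans ?_
        rw [abs_mul]
        exact mul_le_of_le_one_right (abs_nonneg _) (Real.abs_sin_le_one _)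
    simp only [h2, mul_zero, sub_zero] at h1
    linarith
  by_contra! hlt
  have hpos : 0 < b - m := sub_pos.2 hlt
  have h1 := hbound ((D + 1) / (b - m)) (by positivity)
  have h2 : (b - m) * ((D + 1) / (b - m)) = D + 1 := mul_div_cancel₀ _ hpos.ne'
  linarith

theorem norm_sq_sum_exp {J : Type*} [Fintype J] (w y : J → ℝ) (θ : ℝ) :
    ‖∑ j, (w j : ℂ) * Complex.exp (Complex.I * (θ * y j : ℝ))‖ ^ 2 =
      ∑ p : J × J, w p.1 * w p.2 * Real.cos (θ * (y p.1 - y p.2)) := by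
  have h : ∑ j, (w j : ℂ) * Complex.exp (Complex.I * (θ * y j : ℝ)) =
      ((∑ j, w j * Real.cos (θ * y j) : ℝ) : ℂ) +
        ((∑ j, w j * Real.sin (θ * y j) : ℝ) : ℂ) * Complex.I := by
    push_cast
    rw [Finset.sum_mul, ← Finset.sum_add_distrib]
    refine Finset.sum_congr rfl fun j _ => ?_
    rw [mul_comm Complex.I, Complex.exp_mul_I]
    ring
  rw [h, ← Complex.normSq_eq_norm_sq, Complex.normSq_add_mul_I, Fintype.sum_prod_type, sq, sq,
    Finset.sum_mul_sum, Finset.sum_mul_sum, ← Finset.sum_add_distrib]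
  refine Finset.sum_congr rfl fun j _ => ?_
  rw [← Finset.sum_add_distrib]
  refine Finset.sum_congr rfl fun k _ => ?_
  rw [mul_sub, Real.cos_sub]
  ring

/-- If the characteristic function of a finitely supported probability distribution has squared
modulus at least `1 - d` everywhere, then the distribution has an atom of weight `1 - q` with
`q ≤ d` and even `2 q (1 - q) ≤ d`: by averaging over `θ`, the sum of the squares of the weights of
all atoms is at least `1 - d`. -/
theorem exists_atom_of_norm_sq_sum_exp {J : Type*} [Fintype J] (w y : J → ℝ) (d : ℝ)
    (hw : ∀ j, 0 ≤ w j) (hw1 : ∑ j, w j = 1)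
    (h : ∀ θ : ℝ, 1 - d ≤ ‖∑ j, (w j : ℂ) * Complex.exp (Complex.I * (θ * y j : ℝ))‖ ^ 2) :
    ∃ z : ℝ, (∑ j, if y j = z then 0 else w j) ≤ d ∧
      2 * (∑ j, if y j = z then 0 else w j) * (1 - ∑ j, if y j = z then 0 else w j) ≤ d := by
  let Q : ℝ → ℝ := fun z => ∑ j, if y j = z then w j else 0
  have havg : 1 - d ≤ ∑ j, w j * Q (y j) := by
    have h1 := le_sum_const_of_le_sum_cos (fun p : J × J => w p.1 * w p.2)
      (fun p => y p.1 - y p.2) (1 - d) fun θ => by rw [← norm_sq_sum_exp]; exact h θ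
    refine h1.trans (le_of_eq ?_)
    rw [Fintype.sum_prod_type]
    refine Finset.sum_congr rfl fun j _ => ?_
    rw [Finset.mul_sum]
    refine Finset.sum_congr rfl fun k _ => ?_
    simp only [sub_eq_zero, eq_comm (a := y j), mul_ite, mul_zero]
  have hne : (Finset.univ : Finset J).Nonempty := by
    by_contra h0
    rw [Finset.not_nonempty_iff_eq_empty] at h0
    simp [h0] at hw1
  obtain ⟨j₀, -, hj₀⟩ := Finset.exists_max_image Finset.univ (fun j => Q (y j)) hne
  refine ⟨y j₀, ?_⟩
  set q := ∑ j, if y j = y j₀ then 0 else w j with hq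
  have hQq : Q (y j₀) = 1 - q := by
    rw [eq_sub_iff_add_eq, ← hw1, hq, ← Finset.sum_add_distrib]
    refine Finset.sum_congr rfl fun j _ => ?_
    split_ifs <;> simp
  have hle1 : ∑ j, w j * Q (y j) ≤ 1 - q := by
    rw [← hQq, ← one_mul (Q (y j₀)), ← hw1, Finset.sum_mul]
    exact Finset.sum_le_sum fun j hj => mul_le_mul_of_nonneg_left (hj₀ j hj) (hw j)
  -- A point off the chosen atom lies in an atom disjoint from it, of weight at most `q`.
  have hle2 : ∑ j, w j * Q (y j) ≤ (1 - q) * (1 - q) + q * q := by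
    calc ∑ j, w j * Q (y j)
        ≤ ∑ j, ((if y j = y j₀ then w j else 0) * (1 - q) +
            (if y j = y j₀ then 0 else w j) * q) := by
          refine Finset.sum_le_sum fun j _ => ?_
          split_ifs with hj
          · rw [hj, hQq]
            simp
          · rw [zero_mul, zero_add]
            refine mul_le_mul_of_nonneg_left ?_ (hw j)
            rw [hq]
            refine Finset.sum_le_sum fun k _ => ?_
            by_cases hk : y k = y j
            · rw [if_pos hk, if_neg (hk ▸ hj)]
            · rw [if_neg hk]
              split_ifs
              exacts [le_rfl, hw k]
      _ = (1 - q) * (1 - q) + q * q := by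
          rw [Finset.sum_add_distrib, ← Finset.sum_mul, ← Finset.sum_mul, ← hq, ← hQq]
  constructor <;> nlinarith

/-! ### Knill–Laflamme type bound on charge fluctuations -/

section

variable {A B ι κ : Type*} [Fintype A] [Fintype B] [Fintype ι] [Fintype κ]

/-- The difference is `Re ⟨x - t, h (x + t)⟩`; the bound is the polarization identity for this form,
after rescaling `x - t` by `√r` and `x + t` by `1 / √r`. -/
theorem abs_quadForm_sub_quadForm_le {h : Matrix ι ι ℂ} (hh : h.IsHermitian) {m : ℝ}
    (hm : ∀ x : ι → ℂ, |(star x ⬝ᵥ (h *ᵥ x)).re| ≤ m * ∑ i, ‖x i‖ ^ 2) {r : ℝ} (hr : 0 < r)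
    (x t : ι → ℂ) :
    |(star x ⬝ᵥ (h *ᵥ x)).re - (star t ⬝ᵥ (h *ᵥ t)).re| ≤
      m / 2 * (r * ∑ i, ‖x i - t i‖ ^ 2 + r⁻¹ * ∑ i, ‖x i + t i‖ ^ 2) := by
  obtain ⟨s, hs, rfl⟩ : ∃ s : ℝ, 0 < s ∧ r = s ^ 2 :=
    ⟨√r, Real.sqrt_pos.2 hr, (Real.sq_sqrt hr.le).symm⟩
  have hcross : (star t ⬝ᵥ (h *ᵥ x)).re = (star x ⬝ᵥ (h *ᵥ t)).re := by
    rw [star_dotProduct, star_mulVec, hh, ← dotProduct_mulVec, RCLike.star_def, Complex.conj_re]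
  have hquad (a b : ℝ) : (star ((a : ℂ) • x + (b : ℂ) • t) ⬝ᵥ
      (h *ᵥ ((a : ℂ) • x + (b : ℂ) • t))).re = a ^ 2 * (star x ⬝ᵥ (h *ᵥ x)).re +
        b ^ 2 * (star t ⬝ᵥ (h *ᵥ t)).re + 2 * (a * b) * (star x ⬝ᵥ (h *ᵥ t)).re := by
    simp only [star_add, star_smul, RCLike.star_def, Complex.conj_ofReal, mulVec_add, mulVec_smul,
      add_dotProduct, dotProduct_add, smul_dotProduct, dotProduct_smul, smul_eq_mul, Complex.add_re,
      Complex.re_ofReal_mul, hcross]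
    ring
  have hnorm (i : ι) :
      ‖(((s + s⁻¹ : ℝ) : ℂ) • x + ((s⁻¹ - s : ℝ) : ℂ) • t) i‖ ^ 2 +
        ‖(((s - s⁻¹ : ℝ) : ℂ) • x + ((-s⁻¹ - s : ℝ) : ℂ) • t) i‖ ^ 2 =
      2 * (s ^ 2 * ‖x i - t i‖ ^ 2 + (s ^ 2)⁻¹ * ‖x i + t i‖ ^ 2) := by
    simp only [← Complex.normSq_eq_norm_sq, Complex.normSq_apply, Complex.sub_re, Complex.sub_im,
      Complex.add_re, Complex.add_im, Pi.add_apply, Pi.smul_apply, smul_eq_mul,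
      Complex.re_ofReal_mul, Complex.im_ofReal_mul]
    ring
  have hsum := congr_arg (m * ·) (Finset.sum_congr rfl fun i (_ : i ∈ Finset.univ) => hnorm i)
  simp only [Finset.sum_add_distrib, ← Finset.mul_sum] at hsum
  have h1 := abs_le.1 (hm (((s + s⁻¹ : ℝ) : ℂ) • x + ((s⁻¹ - s : ℝ) : ℂ) • t))
  have h2 := abs_le.1 (hm (((s - s⁻¹ : ℝ) : ℂ) • x + ((-s⁻¹ - s : ℝ) : ℂ) • t))
  have h3 : s * s⁻¹ = 1 := mul_inv_cancel₀ hs.ne'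
  have h4 : (star x ⬝ᵥ (h *ᵥ x)).re - (star t ⬝ᵥ (h *ᵥ t)).re =
      ((star (((s + s⁻¹ : ℝ) : ℂ) • x + ((s⁻¹ - s : ℝ) : ℂ) • t) ⬝ᵥ
        (h *ᵥ (((s + s⁻¹ : ℝ) : ℂ) • x + ((s⁻¹ - s : ℝ) : ℂ) • t))).re -
      (star (((s - s⁻¹ : ℝ) : ℂ) • x + ((-s⁻¹ - s : ℝ) : ℂ) • t) ⬝ᵥ
        (h *ᵥ (((s - s⁻¹ : ℝ) : ℂ) • x + ((-s⁻¹ - s : ℝ) : ℂ) • t))).re) / 4 := by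
    rw [hquad, hquad]
    linear_combination
      -((star x ⬝ᵥ (h *ᵥ x)).re - (star t ⬝ᵥ (h *ᵥ t)).re) * h3
  rw [h4, abs_le]
  constructor <;> linarith

theorem sum_quadForm_mul (h : Matrix ι ι ℂ) (c : ι → ℂ) (v : A → ℂ) :
    ∑ l, star (fun i => c i * v l) ⬝ᵥ (h *ᵥ fun i => c i * v l) =
      (star c ⬝ᵥ (h *ᵥ c)) * ((∑ l, ‖v l‖ ^ 2 : ℝ) : ℂ) := by
  push_cast
  rw [Finset.mul_sum]
  refine Finset.sum_congr rfl fun l _ => ?_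
  have h1 : (fun i => c i * v l) = v l • c := by
    ext i
    simp [mul_comm]
  rw [h1, star_smul, smul_dotProduct, mulVec_smul, dotProduct_smul, ← Complex.conj_mul']
  simp only [smul_eq_mul, RCLike.star_def]
  ring

/-- If the Kraus operators `M (k, i)` nearly preserve the entangled input built from unit vectors
`v 0` and `v 1` (entanglement fidelity at least `1 - e²`), then the environment states in the
register `i` for inputs `v 0` and `v 1` have nearly the same expectation of any observable `h`. -/
theorem sum_quadForm_sub_le [DecidableEq ι] {h : Matrix ι ι ℂ} (hh : h.IsHermitian)
    (M : κ × ι → Matrix A A ℂ) {v : Fin 2 → A → ℂ} (hv : ∀ a, ∑ l, ‖v a l‖ ^ 2 = 1)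
    (hM : ∀ a, ∑ k, ∑ l, ∑ i, ‖(M (k, i) *ᵥ v a) l‖ ^ 2 = 1) {e : ℝ} (he : 0 < e)
    (hF : 1 - e ^ 2 ≤ ∑ p, ‖(∑ a, star (v a) ⬝ᵥ (M p *ᵥ v a)) / 2‖ ^ 2) :
    (∑ k, ∑ l, star (fun i => (M (k, i) *ᵥ v 0) l) ⬝ᵥ (h *ᵥ fun i => (M (k, i) *ᵥ v 0) l)).re -
      (∑ k, ∑ l, star (fun i => (M (k, i) *ᵥ v 1) l) ⬝ᵥ (h *ᵥ fun i => (M (k, i) *ᵥ v 1) l)).re ≤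
      2 * e * spread h := by
  obtain ⟨c, hc⟩ := exists_abs_quadForm_sub_le hh
  set m := spread h / 2 with hm
  have hm0 : 0 ≤ m := by have := spread_nonneg hh; positivity
  let h' : Matrix ι ι ℂ := h - (c : ℂ) • (1 : Matrix ι ι ℂ)
  have hh' : h'.IsHermitian := by
    refine hh.sub ?_
    rw [IsHermitian, conjTranspose_smul, conjTranspose_one, RCLike.star_def, Complex.conj_ofReal]
  have hquad (x : ι → ℂ) : (star x ⬝ᵥ (h' *ᵥ x)).re =
      (star x ⬝ᵥ (h *ᵥ x)).re - c * ∑ i, ‖x i‖ ^ 2 := by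
    rw [sub_mulVec, dotProduct_sub, smul_mulVec, one_mulVec, dotProduct_smul, star_dotProduct_self,
      Complex.sub_re, smul_eq_mul, ← Complex.ofReal_mul, Complex.ofReal_re]
  have hm' (x : ι → ℂ) : |(star x ⬝ᵥ (h' *ᵥ x)).re| ≤ m * ∑ i, ‖x i‖ ^ 2 := by
    rw [hquad]
    exact hc x
  -- The blocks `t` are those of the projection of `x` to the vectors of the form `vₐ ⊗ c`.
  let g : κ × ι → ℂ := fun p => (∑ a, star (v a) ⬝ᵥ (M p *ᵥ v a)) / 2
  set F := ∑ p, ‖g p‖ ^ 2 with hFdef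
  let x : Fin 2 → κ → A → ι → ℂ := fun a k l i => (M (k, i) *ᵥ v a) l
  let t : Fin 2 → κ → A → ι → ℂ := fun a k l i => g (k, i) * v a l
  let q : (ι → ℂ) → ℝ := fun z => (star z ⬝ᵥ (h' *ᵥ z)).re
  have hqx (a : Fin 2) : ∑ k, ∑ l, q (x a k l) =
      (∑ k, ∑ l, star (x a k l) ⬝ᵥ (h *ᵥ x a k l)).re - c := by
    simp only [q, hquad, Finset.sum_sub_distrib, Complex.re_sum, ← Finset.mul_sum]
    rw [hM a, mul_one]
  -- This value does not depend on `a`, so it cancels in the difference of `a = 0` and `a = 1`.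
  have hqt (a : Fin 2) : ∑ k, ∑ l, q (t a k l) =
      ∑ k, (star (fun i => g (k, i)) ⬝ᵥ (h' *ᵥ fun i => g (k, i))).re := by
    refine Finset.sum_congr rfl fun k _ => ?_
    rw [← Complex.re_sum, sum_quadForm_mul, hv, Complex.ofReal_one, mul_one]
  have hx2 : ∑ a, ∑ k, ∑ l, ∑ i, ‖x a k l i‖ ^ 2 = 2 := by
    simp [x, hM]
  have ht2 : ∑ a, ∑ k, ∑ l, ∑ i, ‖t a k l i‖ ^ 2 = 2 * F := by
    have h1 (a : Fin 2) (k : κ) : ∑ l, ∑ i, ‖t a k l i‖ ^ 2 = ∑ i, ‖g (k, i)‖ ^ 2 := by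
      rw [Finset.sum_comm]
      refine Finset.sum_congr rfl fun i _ => ?_
      simp only [t, norm_mul, mul_pow, ← Finset.mul_sum, hv, mul_one]
    simp only [h1, Finset.sum_const, Finset.card_univ, Fintype.card_fin, hFdef,
      Fintype.sum_prod_type, nsmul_eq_mul, Nat.cast_ofNat]
  have hxt : ∑ a, ∑ k, ∑ l, ∑ i, (star (t a k l i) * x a k l i).re = 2 * F := by
    have h1 : ∑ a, ∑ k, ∑ l, ∑ i, star (t a k l i) * x a k l i = ((2 * F : ℝ) : ℂ) := by
      have h2 (a : Fin 2) : ∑ k, ∑ l, ∑ i, star (t a k l i) * x a k l i =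
          ∑ p, star (g p) * (star (v a) ⬝ᵥ (M p *ᵥ v a)) := by
        rw [Fintype.sum_prod_type]
        refine Finset.sum_congr rfl fun k _ => ?_
        rw [Finset.sum_comm]
        refine Finset.sum_congr rfl fun i _ => ?_
        simp only [dotProduct, Finset.mul_sum, t, x, star_mul', Pi.star_apply, mul_assoc]
      simp only [h2]
      rw [Finset.sum_comm, hFdef, Finset.mul_sum]
      push_cast
      refine Finset.sum_congr rfl fun p _ => ?_
      rw [← Finset.mul_sum, ← Complex.conj_mul', RCLike.star_def]
      simp only [g]
      ring
    have h2 := congr_arg Complex.re h1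
    simpa only [Complex.re_sum, Complex.ofReal_re] using h2
  have hsub : ∑ a, ∑ k, ∑ l, ∑ i, ‖x a k l i - t a k l i‖ ^ 2 = 2 - 2 * F := by
    have h1 (a b : ℂ) : ‖a - b‖ ^ 2 = ‖a‖ ^ 2 + ‖b‖ ^ 2 - 2 * (star b * a).re := by
      simp only [← Complex.normSq_eq_norm_sq, Complex.normSq_apply, Complex.sub_re, Complex.sub_im,
        RCLike.star_def, Complex.mul_re, Complex.conj_re, Complex.conj_im]
      ring
    simp only [h1, Finset.sum_sub_distrib, Finset.sum_add_distrib, ← Finset.mul_sum]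
    rw [hx2, ht2, hxt]
    ring
  have hadd : ∑ a, ∑ k, ∑ l, ∑ i, ‖x a k l i + t a k l i‖ ^ 2 = 2 + 6 * F := by
    have h1 (a b : ℂ) : ‖a + b‖ ^ 2 = ‖a‖ ^ 2 + ‖b‖ ^ 2 + 2 * (star b * a).re := by
      simp only [← Complex.normSq_eq_norm_sq, Complex.normSq_apply, Complex.add_re, Complex.add_im,
        RCLike.star_def, Complex.mul_re, Complex.conj_re, Complex.conj_im]
      ring
    simp only [h1, Finset.sum_add_distrib, ← Finset.mul_sum]
    rw [hx2, ht2, hxt]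
    ring
  have hF1 : 0 ≤ 2 - 2 * F := by
    rw [← hsub]
    positivity
  -- `‖x - t‖² ≤ 2 e²` and `‖x + t‖² ≤ 8`; the weight `2 / e` balances the two terms.
  have hdiff (a : Fin 2) : |∑ k, ∑ l, q (x a k l) - ∑ k, ∑ l, q (t a k l)| ≤
      ∑ k, ∑ l, m / 2 * (2 / e * ∑ i, ‖x a k l i - t a k l i‖ ^ 2 +
        (2 / e)⁻¹ * ∑ i, ‖x a k l i + t a k l i‖ ^ 2) := by
    simp only [← Finset.sum_sub_distrib]
    refine (Finset.abs_sum_le_sum_abs _ _).trans (Finset.sum_le_sum fun k _ => ?_)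
    refine (Finset.abs_sum_le_sum_abs _ _).trans (Finset.sum_le_sum fun l _ => ?_)
    exact abs_quadForm_sub_quadForm_le hh' hm' (by positivity) _ _
  have htotal : ∑ a, ∑ k, ∑ l, m / 2 * (2 / e * ∑ i, ‖x a k l i - t a k l i‖ ^ 2 +
        (2 / e)⁻¹ * ∑ i, ‖x a k l i + t a k l i‖ ^ 2) =
      m / 2 * (2 / e * (2 - 2 * F) + (2 / e)⁻¹ * (2 + 6 * F)) := by
    simp only [← hsub, ← hadd, Finset.mul_sum, Finset.sum_add_distrib, mul_add]
  have hfinal : m / 2 * (2 / e * (2 - 2 * F) + (2 / e)⁻¹ * (2 + 6 * F)) ≤ 2 * e * spread h := by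
    have h1 : 2 / e * (2 - 2 * F) ≤ 4 * e := by
      rw [div_mul_eq_mul_div, div_le_iff₀ he]
      nlinarith
    have h2 : (2 / e)⁻¹ * (2 + 6 * F) ≤ 4 * e := by
      rw [inv_div]
      nlinarith
    have h3 : spread h = 2 * m := by rw [hm]; ring
    rw [h3]
    nlinarith
  rw [Fin.sum_univ_two] at htotal
  have h0 := (abs_le.1 (hdiff 0)).2
  have h1 := (abs_le.1 (hdiff 1)).1
  rw [hqx, hqt] at h0 h1
  linarith

end

/-! ### Charge fluctuation versus recoverability -/

section

variable {L S ι κ : Type*} [Fintype L] [Fintype S] [Fintype ι] [Fintype κ]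

theorem sum_star_mulVec_dotProduct_mulVec [DecidableEq S] {M : κ → Matrix L S ℂ}
    (hM : ∑ k, (M k)ᴴ * M k = 1) (x y : S → ℂ) :
    ∑ k, star (M k *ᵥ x) ⬝ᵥ (M k *ᵥ y) = star x ⬝ᵥ y := by
  simp only [star_mulVec_dotProduct_mulVec]
  rw [← dotProduct_sum, ← sum_mulVec, hM, one_mulVec]

/-- The expectation of `∑ᵢⱼ hᵢⱼ Kᵢ† Kⱼ` is an expectation of `h` in the environment register `i`,
whatever is done afterwards to the system by the operators `M k`. -/
theorem sum_quadForm_kraus [DecidableEq S] {M : κ → Matrix L S ℂ} (hM : ∑ k, (M k)ᴴ * M k = 1)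
    (K : ι → Matrix S S ℂ) (h : Matrix ι ι ℂ) (u : S → ℂ) :
    ∑ k, ∑ l, star (fun i => (M k *ᵥ (K i *ᵥ u)) l) ⬝ᵥ (h *ᵥ fun i => (M k *ᵥ (K i *ᵥ u)) l) =
      star u ⬝ᵥ ((∑ i, ∑ j, h i j • ((K i)ᴴ * K j)) *ᵥ u) := by
  have h1 (i j : ι) : star u ⬝ᵥ ((h i j • ((K i)ᴴ * K j)) *ᵥ u) =
      ∑ k, ∑ l, star ((M k *ᵥ (K i *ᵥ u)) l) * (h i j * (M k *ᵥ (K j *ᵥ u)) l) := by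
    rw [smul_mulVec, dotProduct_smul, ← star_mulVec_dotProduct_mulVec,
      ← sum_star_mulVec_dotProduct_mulVec hM, smul_eq_mul, Finset.mul_sum]
    refine Finset.sum_congr rfl fun k _ => ?_
    simp only [dotProduct, Finset.mul_sum, Pi.star_apply]
    exact Finset.sum_congr rfl fun l _ => by ring
  simp only [sum_mulVec, dotProduct_sum, h1]
  simp only [dotProduct, mulVec, Finset.mul_sum, Pi.star_apply]
  have hswap (f : κ → L → ι → ℂ) : ∑ k, ∑ l, ∑ i, f k l i = ∑ i, ∑ k, ∑ l, f k l i :=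
    (Finset.sum_congr rfl fun k _ => Finset.sum_comm).trans Finset.sum_comm
  rw [hswap]
  exact Finset.sum_congr rfl fun i _ => hswap _

/-- The entanglement fidelity of the recovered code on the input built from `v 0` and `v 1` is at
least `1 - d²`, where `d` is the channel distance. -/
theorem charge_fluctuation_le_of_recovery [DecidableEq L] [DecidableEq S] [DecidableEq ι]
    {R : Matrix S S ℂ →ₗ[ℂ] Matrix L L ℂ} (hR : IsChannel R) {K : ι → Matrix S S ℂ}
    (hK : ∑ i, (K i)ᴴ * K i = 1) {W : Matrix S L ℂ} (hW : Wᴴ * W = 1) {h : Matrix ι ι ℂ}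
    (hh : h.IsHermitian) {v : Fin 2 → L → ℂ} (hv : ∀ a, ∑ l, ‖v a l‖ ^ 2 = 1) :
    (star (W *ᵥ v 0) ⬝ᵥ ((∑ i, ∑ j, h i j • ((K i)ᴴ * K j)) *ᵥ (W *ᵥ v 0))).re -
      (star (W *ᵥ v 1) ⬝ᵥ ((∑ i, ∑ j, h i j • ((K i)ᴴ * K j)) *ᵥ (W *ᵥ v 1))).re ≤
      2 * (channelDist (R ∘ₗ krausMap K ∘ₗ conjMap W) LinearMap.id * spread h) := by
  obtain ⟨Q, rfl, hQ⟩ := hR.exists_krausMap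
  set d := channelDist (krausMap Q ∘ₗ krausMap K ∘ₗ conjMap W) LinearMap.id with hd
  have hd0 : 0 ≤ d := channelDist_nonneg _ _
  let M : (L × Fin (Fintype.card S)) × ι → Matrix L L ℂ := fun p => Q p.1 * (K p.2 * W)
  have hMv (p) (x : L → ℂ) : M p *ᵥ x = Q p.1 *ᵥ (K p.2 *ᵥ (W *ᵥ x)) := by
    simp only [M, mulVec_mulVec]
  have hF : 1 - d ^ 2 ≤ ∑ p, ‖(∑ a, star (v a) ⬝ᵥ (M p *ᵥ v a)) / 2‖ ^ 2 := by
    have h1 := one_sub_channelDist_sq_le M 1 hv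
    simp only [one_mulVec] at h1
    rwa [conjMap_one, ← krausMap_comp_krausMap Q fun i => K i * W, ← krausMap_comp_conjMap,
      ← hd] at h1
  have hM (a : Fin 2) : ∑ k, ∑ l, ∑ i, ‖(M (k, i) *ᵥ v a) l‖ ^ 2 = 1 := by
    have h1 : ((∑ k, ∑ l, ∑ i, ‖(M (k, i) *ᵥ v a) l‖ ^ 2 : ℝ) : ℂ) = 1 := by
      have h2 (k) : ((∑ l, ∑ i, ‖(M (k, i) *ᵥ v a) l‖ ^ 2 : ℝ) : ℂ) =
          ∑ i, star (Q k *ᵥ (K i *ᵥ (W *ᵥ v a))) ⬝ᵥ (Q k *ᵥ (K i *ᵥ (W *ᵥ v a))) := by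
        rw [Finset.sum_comm, Complex.ofReal_sum]
        simp only [star_dotProduct_self, hMv]
      rw [Complex.ofReal_sum]
      simp only [h2]
      rw [Finset.sum_comm]
      simp only [sum_star_mulVec_dotProduct_mulVec hQ]
      rw [sum_star_mulVec_dotProduct_mulVec hK, star_mulVec_dotProduct_mulVec, hW, one_mulVec,
        star_dotProduct_self, hv, Complex.ofReal_one]
    exact_mod_cast h1
  have hmain (e : ℝ) (he : 0 < e) (hde : d ≤ e) :
      (star (W *ᵥ v 0) ⬝ᵥ ((∑ i, ∑ j, h i j • ((K i)ᴴ * K j)) *ᵥ (W *ᵥ v 0))).re -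
        (star (W *ᵥ v 1) ⬝ᵥ ((∑ i, ∑ j, h i j • ((K i)ᴴ * K j)) *ᵥ (W *ᵥ v 1))).re ≤
      2 * e * spread h := by
    have h1 := sum_quadForm_sub_le hh M hv hM he (by nlinarith)
    simp only [hMv] at h1
    rwa [sum_quadForm_kraus hQ, sum_quadForm_kraus hQ] at h1
  have hs := spread_nonneg hh
  refine le_of_forall_pos_le_add fun η hη => ?_
  have hs1 : 0 < 2 * (spread h + 1) := by linarith
  refine (hmain (d + η / (2 * (spread h + 1))) (by positivity) (by
    have : 0 < η / (2 * (spread h + 1)) := by positivity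
    linarith)).trans ?_
  have h2 : η / (2 * (spread h + 1)) * (2 * (spread h + 1)) = η := div_mul_cancel₀ _ hs1.ne'
  have h3 : 0 < η / (2 * (spread h + 1)) := by positivity
  nlinarith

/-- A Hermitian element of the span of the `Kᵢ† Kⱼ` has a Hermitian coefficient matrix. -/
theorem exists_isHermitian_of_mem_span {H : Matrix S S ℂ} (hH : H.IsHermitian)
    {K : ι → Matrix S S ℂ}
    (hmem : H ∈ Submodule.span ℂ (Set.range fun p : ι × ι => (K p.1)ᴴ * K p.2)) :
    ∃ h : Matrix ι ι ℂ, h.IsHermitian ∧ H = ∑ i, ∑ j, h i j • ((K i)ᴴ * K j) := by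
  obtain ⟨c, hc⟩ := (Submodule.mem_span_range_iff_exists_fun ℂ).1 hmem
  rw [Fintype.sum_prod_type] at hc
  refine ⟨of fun i j => (c (i, j) + star (c (j, i))) / 2, ?_, ?_⟩
  · ext i j
    simp [add_comm]
  · have hc' : ∑ i, ∑ j, star (c (j, i)) • ((K i)ᴴ * K j) = H := by
      rw [← hH.eq, ← hc, Finset.sum_comm]
      simp [conjTranspose_sum, conjTranspose_smul, conjTranspose_mul]
    have h1 : ∑ i, ∑ j, ((c (i, j) + star (c (j, i))) / 2) • ((K i)ᴴ * K j) =
        (2 : ℂ)⁻¹ • (∑ i, ∑ j, c (i, j) • ((K i)ᴴ * K j) +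
          ∑ i, ∑ j, star (c (j, i)) • ((K i)ᴴ * K j)) := by
      simp only [← Finset.sum_add_distrib, Finset.smul_sum, ← add_smul, smul_smul]
      refine Finset.sum_congr rfl fun i _ => Finset.sum_congr rfl fun j _ => ?_
      congr 1
      ring
    simp only [of_apply]
    rw [h1, hc, hc', ← two_smul ℂ H, smul_smul, inv_mul_cancel₀ two_ne_zero, one_smul]

theorem le_sInf_mul {s : Set ℝ} (hs : s.Nonempty) {c y : ℝ} (hy : 0 ≤ y)
    (h : ∀ x ∈ s, c ≤ x * y) : c ≤ sInf s * y := by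
  rcases hy.eq_or_lt with rfl | hy
  · obtain ⟨x, hx⟩ := hs
    simpa using h x hx
  · rw [← div_le_iff₀ hy]
    exact le_csInf hs fun x hx => (div_le_iff₀ hy).2 (h x hx)

theorem le_sInf_mul_sInf {s t : Set ℝ} (hs : s.Nonempty) (ht : t.Nonempty)
    (hs0 : ∀ x ∈ s, 0 ≤ x) (ht0 : ∀ y ∈ t, 0 ≤ y) {c : ℝ}
    (h : ∀ x ∈ s, ∀ y ∈ t, c ≤ x * y) : c ≤ sInf s * sInf t := by
  rw [mul_comm]
  refine le_sInf_mul ht (Real.sInf_nonneg hs0) fun y hy => ?_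
  rw [mul_comm]
  exact le_sInf_mul hs (ht0 y hy) fun x hx => h x hx y hy

/-- The charge fluctuation is at most `2 ε 𝔍`. Both infima are over nonempty sets: a Hermitian `h`
exists by the span condition, and a channel exists because `L` is nonempty. -/
theorem charge_fluctuation_le [DecidableEq L] [DecidableEq S] [DecidableEq ι] [Nonempty L]
    {H : Matrix S S ℂ} (hH : H.IsHermitian) {K : ι → Matrix S S ℂ}
    (hK : ∑ i, (K i)ᴴ * K i = 1) {W : Matrix S L ℂ} (hW : Wᴴ * W = 1)
    (hmem : H ∈ Submodule.span ℂ (Set.range fun p : ι × ι => (K p.1)ᴴ * K p.2))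
    {v : Fin 2 → L → ℂ} (hv : ∀ a, ∑ l, ‖v a l‖ ^ 2 = 1) :
    (star (W *ᵥ v 0) ⬝ᵥ (H *ᵥ (W *ᵥ v 0))).re - (star (W *ᵥ v 1) ⬝ᵥ (H *ᵥ (W *ᵥ v 1))).re ≤
      2 * qecInaccuracy (krausMap K) (conjMap W) * minKrausSpread H K := by
  rw [mul_assoc, ← div_le_iff₀' two_pos]
  obtain ⟨h₀, hh₀, hH₀⟩ := exists_isHermitian_of_mem_span hH hmem
  obtain ⟨R₀, hR₀⟩ := exists_isChannel S L
  apply le_sInf_mul_sInf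
  · exact ⟨_, R₀, hR₀, rfl⟩
  · exact ⟨_, h₀, hh₀, hH₀, rfl⟩
  · rintro x ⟨R, -, rfl⟩
    exact channelDist_nonneg _ _
  · rintro y ⟨h, hh, -, rfl⟩
    exact spread_nonneg hh
  · rintro x ⟨R, hR, rfl⟩ y ⟨h, hh, hHh, rfl⟩
    rw [div_le_iff₀' two_pos]
    have h1 := charge_fluctuation_le_of_recovery hR hK hW hh hv
    rwa [← hHh] at h1

/-! ### Charge fluctuation versus covariance violation -/

theorem globalViolation_nonneg [DecidableEq L] [DecidableEq S] (HL : Matrix L L ℂ)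
    (HS : Matrix S S ℂ) (E : Matrix L L ℂ →ₗ[ℂ] Matrix S S ℂ) : 0 ≤ globalViolation HL HS E :=
  Real.iSup_nonneg fun _ => channelDist_nonneg _ _

/-- Overlap of the two evolutions on the entangled input built from two eigenvectors of `HL`: the
characteristic function of the charge difference `λ - μ`. -/
theorem one_sub_globalViolation_sq_le [DecidableEq L] [DecidableEq S] {HL : Matrix L L ℂ}
    {HS : Matrix S S ℂ} (hHL : HL.IsHermitian) (hHS : HS.IsHermitian) (W : Matrix S L ℂ)
    (s : Fin 2 → L) (θ : ℝ) :
    1 - globalViolation HL HS (conjMap W) ^ 2 ≤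
      ‖∑ p : Fin 2 × S, ((eigenWeight hHS (W *ᵥ ⇑(hHL.eigenvectorBasis (s p.1))) p.2 / 2 : ℝ) : ℂ) *
        Complex.exp (Complex.I * (θ * (hHL.eigenvalues (s p.1) - hHS.eigenvalues p.2) : ℝ))‖
          ^ 2 := by
  have hle : channelDist (evolution HS θ ∘ₗ conjMap W) (conjMap W ∘ₗ evolution HL θ) ≤
      globalViolation HL HS (conjMap W) :=
    le_ciSup (f := fun θ : ℝ => channelDist (evolution HS θ ∘ₗ conjMap W)
      (conjMap W ∘ₗ evolution HL θ)) ⟨1, by rintro _ ⟨θ, rfl⟩; exact channelDist_le_one _ _⟩ θ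
  have h0 := channelDist_nonneg (evolution HS θ ∘ₗ conjMap W) (conjMap W ∘ₗ evolution HL θ)
  let v : Fin 2 → L → ℂ := fun a => ⇑(hHL.eigenvectorBasis (s a))
  have hv : ∀ a, ∑ l, ‖v a l‖ ^ 2 = 1 := fun a => sum_norm_sq_eigenvector hHL (s a)
  have h1 := one_sub_channelDist_sq_le
    (fun _ : Unit => NormedSpace.exp ((-(Complex.I * (θ : ℂ))) • HS) * W)
    (W * NormedSpace.exp ((-(Complex.I * (θ : ℂ))) • HL)) hv
  rw [← conjMap_eq_krausMap, ← conjMap_comp_conjMap, ← conjMap_comp_conjMap,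
    Fintype.sum_unique] at h1
  have h2 : (∑ a, star ((W * NormedSpace.exp ((-(Complex.I * (θ : ℂ))) • HL)) *ᵥ v a) ⬝ᵥ
      ((NormedSpace.exp ((-(Complex.I * (θ : ℂ))) • HS) * W) *ᵥ v a)) / 2 =
      ∑ p : Fin 2 × S, ((eigenWeight hHS (W *ᵥ v p.1) p.2 / 2 : ℝ) : ℂ) *
        Complex.exp (Complex.I * (θ * (hHL.eigenvalues (s p.1) - hHS.eigenvalues p.2) : ℝ)) := by
    rw [Fintype.sum_prod_type, Finset.sum_div]
    refine Finset.sum_congr rfl fun a _ => ?_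
    rw [← mulVec_mulVec, ← mulVec_mulVec, exp_smul_mulVec_eigenvector, mulVec_smul, star_smul,
      smul_dotProduct, quadForm_exp_eq_sum hHS, smul_eq_mul, Finset.mul_sum, Finset.sum_div]
    refine Finset.sum_congr rfl fun t _ => ?_
    rw [RCLike.star_def, ← Complex.exp_conj]
    have h3 : Complex.I * ((θ * (hHL.eigenvalues (s a) - hHS.eigenvalues t) : ℝ) : ℂ) =
        (starRingEnd ℂ) (-(Complex.I * (θ : ℂ)) * (hHL.eigenvalues (s a) : ℂ)) +
          -(Complex.I * (θ : ℂ)) * (hHS.eigenvalues t : ℂ) := by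
      simp only [map_mul, map_neg, Complex.conj_I, Complex.conj_ofReal]
      push_cast
      ring
    rw [h3, Complex.exp_add]
    push_cast
    ring
  rw [h2] at h1
  refine le_trans ?_ h1
  exact sub_le_sub_left (pow_le_pow_left₀ h0 hle 2) 1

/-- A probability distribution on numbers spread over an interval of length `Δ` has mean at distance
at most `q Δ` from any of its atoms, where `q` is the weight off that atom. -/
theorem abs_sub_mean_le {J : Type*} [Fintype J] {p μ : J → ℝ} {Δ : ℝ} (hp : ∀ j, 0 ≤ p j)
    (hp1 : ∑ j, p j = 1) (hΔ : ∀ j k, μ j - μ k ≤ Δ) (j₀ : J) :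
    |μ j₀ - ∑ j, μ j * p j| ≤ (∑ j, if μ j = μ j₀ then 0 else p j) * Δ := by
  have h1 : μ j₀ - ∑ j, μ j * p j = ∑ j, (μ j₀ - μ j) * p j := by
    simp only [sub_mul, Finset.sum_sub_distrib, ← Finset.mul_sum, hp1, mul_one]
  rw [h1, Finset.sum_mul]
  refine (Finset.abs_sum_le_sum_abs _ _).trans (Finset.sum_le_sum fun j _ => ?_)
  split_ifs with hj
  · simp [hj]
  · rw [abs_mul, abs_of_nonneg (hp j), mul_comm]
    exact mul_le_mul_of_nonneg_left (abs_le.2 ⟨by linarith [hΔ j j₀], hΔ j₀ j⟩) (hp j)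

/-- The number `q` is the weight off the largest atom of the distribution of `λ - μ`. -/
theorem exists_spread_sub_charge_fluctuation_le [DecidableEq L] [DecidableEq S]
    {HL : Matrix L L ℂ} {HS : Matrix S S ℂ} (hHL : HL.IsHermitian) (hHS : HS.IsHermitian)
    {W : Matrix S L ℂ} (hW : Wᴴ * W = 1) (s : Fin 2 → L)
    (hδ : globalViolation HL HS (conjMap W) < 1 / 2) :
    ∃ q : ℝ, q ≤ 1 / 4 ∧ 2 * q * (1 - q) ≤ globalViolation HL HS (conjMap W) ^ 2 ∧
      hHL.eigenvalues (s 0) - hHL.eigenvalues (s 1) -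
        ((star (W *ᵥ ⇑(hHL.eigenvectorBasis (s 0))) ⬝ᵥ
            (HS *ᵥ (W *ᵥ ⇑(hHL.eigenvectorBasis (s 0))))).re -
          (star (W *ᵥ ⇑(hHL.eigenvectorBasis (s 1))) ⬝ᵥ
            (HS *ᵥ (W *ᵥ ⇑(hHL.eigenvectorBasis (s 1))))).re) ≤ 2 * q * spread HS := by
  have hδ0 := globalViolation_nonneg HL HS (conjMap W)
  set δ := globalViolation HL HS (conjMap W) with hδdef
  let p : Fin 2 → S → ℝ := fun a => eigenWeight hHS (W *ᵥ ⇑(hHL.eigenvectorBasis (s a)))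
  have hp (a t) : 0 ≤ p a t := eigenWeight_nonneg _ _ _
  have hp1 (a : Fin 2) : ∑ t, p a t = 1 := by
    have h1 := star_mulVec_dotProduct_mulVec W W (⇑(hHL.eigenvectorBasis (s a)) : L → ℂ)
      (⇑(hHL.eigenvectorBasis (s a)) : L → ℂ)
    rw [hW, one_mulVec, star_dotProduct_self, star_dotProduct_self, sum_norm_sq_eigenvector] at h1
    rw [sum_eigenWeight]
    exact_mod_cast h1
  obtain ⟨z, hz1, hz2⟩ := exists_atom_of_norm_sq_sum_exp
    (fun x : Fin 2 × S => p x.1 x.2 / 2)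
    (fun x => hHL.eigenvalues (s x.1) - hHS.eigenvalues x.2) (δ ^ 2)
    (fun x => div_nonneg (hp _ _) two_pos.le)
    (by simp [Fintype.sum_prod_type, ← Finset.sum_div, hp1])
    (fun θ => one_sub_globalViolation_sq_le hHL hHS W s θ)
  set q := ∑ x : Fin 2 × S, if hHL.eigenvalues (s x.1) - hHS.eigenvalues x.2 = z then 0
    else p x.1 x.2 / 2 with hq
  let r : Fin 2 → ℝ := fun a =>
    ∑ t, if hHL.eigenvalues (s a) - hHS.eigenvalues t = z then 0 else p a t
  have hqr : r 0 + r 1 = 2 * q := by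
    rw [hq, Fintype.sum_prod_type, Fin.sum_univ_two, mul_add, Finset.mul_sum, Finset.mul_sum]
    congr 1 <;>
    · refine Finset.sum_congr rfl fun t _ => ?_
      split_ifs
      · simp
      · ring
  have hr0 (a : Fin 2) : 0 ≤ r a := Finset.sum_nonneg fun t _ => by
    split_ifs
    exacts [le_rfl, hp a t]
  have hq4 : q ≤ 1 / 4 := by nlinarith
  have hr1 (a : Fin 2) : r a < 1 := by
    have h0 := hr0 0
    have h1 := hr0 1
    fin_cases a <;> simp <;> linarith
  have hmean (a : Fin 2) : |hHL.eigenvalues (s a) - z - ∑ t, hHS.eigenvalues t * p a t| ≤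
      r a * spread HS := by
    -- The off-atom weight is below `1`, so the atom is an eigenvalue of `HS`.
    obtain ⟨t₀, ht₀⟩ : ∃ t, hHL.eigenvalues (s a) - hHS.eigenvalues t = z := by
      by_contra! hne
      have := hr1 a
      simp only [r, hne, if_false, hp1] at this
      exact lt_irrefl _ this
    have h1 := abs_sub_mean_le (hp a) (hp1 a) (eigenvalues_sub_le_spread hHS) t₀
    have h2 : hHL.eigenvalues (s a) - z = hHS.eigenvalues t₀ := by linarith
    rw [h2]
    refine h1.trans (le_of_eq ?_)
    congr 1
    refine Finset.sum_congr rfl fun t _ => ?_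
    congr 1
    rw [← ht₀, sub_right_inj]
  refine ⟨q, hq4, hz2, ?_⟩
  rw [quadForm_eq_sum hHS, quadForm_eq_sum hHS, Complex.ofReal_re, Complex.ofReal_re, ← hqr]
  have h0 := (abs_le.1 (hmean 0)).2
  have h1 := (abs_le.1 (hmean 1)).1
  simp only [p] at h0 h1
  linarith

end

end CovariantCodes

theorem theorem1 :
    ∃ ℓ : ℝ → ℝ, (fun y => ℓ y - y) =O[𝓝 0] (fun y => y ^ 2) ∧
      ∀ (L S ι : Type*) [Fintype L] [Fintype S] [Fintype ι] [Nonempty L]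
        [DecidableEq L] [DecidableEq S] [DecidableEq ι]
        (HL : Matrix L L ℂ) (HS : Matrix S S ℂ) (W : Matrix S L ℂ) (K : ι → Matrix S S ℂ),
        HL.IsHermitian → HS.IsHermitian →
        0 < CovariantCodes.spread HS →
        Wᴴ * W = 1 →
        ∑ i, (K i)ᴴ * K i = 1 →
        HS ∈ Submodule.span ℂ (Set.range fun p : ι × ι => (K p.1)ᴴ * K p.2) →
        ℓ (√((CovariantCodes.spread HL
              - 2 * CovariantCodes.qecInaccuracy (CovariantCodes.krausMap K)
                  (CovariantCodes.conjMap W) * CovariantCodes.minKrausSpread HS K)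
            / CovariantCodes.spread HS))
          ≤ CovariantCodes.globalViolation HL HS (CovariantCodes.conjMap W) := by
  refine ⟨fun y => y - y ^ 2, ?_, ?_⟩
  · refine (IsBigO.of_bound 1 (Filter.Eventually.of_forall fun y => ?_))
    simp
  intro L S ι _ _ _ _ _ _ _ HL HS W K hHL hHS hΔ hW hK hmem
  obtain ⟨s₀, s₁, hs⟩ := CovariantCodes.exists_eigenvalues_sub_eq_spread hHL
  have hfluct := CovariantCodes.charge_fluctuation_le hHS hK hW hmem
    (v := fun a => ⇑(hHL.eigenvectorBasis (![s₀, s₁] a)))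
    fun a => CovariantCodes.sum_norm_sq_eigenvector hHL _
  have hδ0 := CovariantCodes.globalViolation_nonneg HL HS (CovariantCodes.conjMap W)
  set δ := CovariantCodes.globalViolation HL HS (CovariantCodes.conjMap W) with hδ
  set D := CovariantCodes.spread HL - 2 * CovariantCodes.qecInaccuracy (CovariantCodes.krausMap K)
    (CovariantCodes.conjMap W) * CovariantCodes.minKrausSpread HS K with hD
  set y := √(D / CovariantCodes.spread HS) with hy
  have hy0 : 0 ≤ y := Real.sqrt_nonneg _
  -- `y - y²` never exceeds `1 / 4`, so only small violations matter.
  rcases le_or_gt (1 / 2) δ with hbig | hsmall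
  · nlinarith [sq_nonneg (y - 1 / 2)]
  rcases le_or_gt D 0 with hD0 | hD0
  · have : y = 0 := Real.sqrt_eq_zero_of_nonpos (div_nonpos_of_nonpos_of_nonneg hD0 hΔ.le)
    simpa [this] using hδ0
  -- `D > 0` is at most the excess of `ΔHL` over the charge fluctuation.
  obtain ⟨q, hq4, hqδ, hq⟩ := CovariantCodes.exists_spread_sub_charge_fluctuation_le hHL hHS hW
    ![s₀, s₁] hsmall
  simp only [cons_val_zero, cons_val_one, hs] at hq hfluct
  have hyq : y ^ 2 ≤ 2 * q := by
    rw [hy, Real.sq_sqrt (div_nonneg hD0.le hΔ.le), div_le_iff₀ hΔ]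
    linarith
  rw [← hδ] at hqδ
  have hyδ : y ^ 2 * (1 - y ^ 2 / 2) ≤ δ ^ 2 := by nlinarith
  have hy1 : y ≤ 1 := by nlinarith
  refine le_of_sq_le_sq ?_ hδ0
  refine le_trans ?_ hyδ
  nlinarith [mul_nonneg (pow_nonneg hy0 3) (sub_nonneg.2 hy1)]
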